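/- **Conventions.** A *pseudo-length function* on a group $\Gamma$ with neutral element $e$ is a map $\ell:\Gamma\to[0,\infty)$ with $\ell(e)=0$, $\ell(gh)\le \ell(g)+\ell(h)$ and $\ell(g^{-1})=\ell(g)$ for all $g,h\in\Gamma$; it is a *length function* if moreover $\ell(g)=0$ only for $g=e$, and it is *proper* if $\{g\in \Gamma : \ell(g)\le r\}$ is finite for every $r$. An *invariant mean* on $\Gamma$ is a state $\mu$ on $\ell^\infty(\Gamma)$ (complex-valued bounded functions) with $\mu(g.f)=\mu(f)$ for all $g\in \Gamma$, $f\in\ell^\infty(\Gamma)$, where $(g.f)(h)=f(g^{-1}h)$. Put $\varphi_g^\ell(h):=\ell(h)-\ell(g^{-1}h)$, a bounded function on $\Gamma$. For finitely generated $\Gamma$ let $p_\Gamma$ be the projection of $\Gamma$ onto the torsion-free component of its Abelianization, i.e. onto the quotient of $\Gamma/[\Gamma,\Gamma]$ by its torsion subgroup. Every invariant mean $\mu$ induces a homomorphism $\widehat\mu_\ell:\operatorname{im}(p_\Gamma)\to\mathbb R$, $p_\Gamma(g)\mapsto\mu(\varphi_g^\ell)$. The group $\Gamma$ is *separated with respect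 to $\ell$* if $$\operatorname{Hom}(\operatorname{im}(p_\Gamma),\mathbb R)=\operatorname{Span}_{\mathbb R}\{\widehat\mu_\ell : \mu \text{ an invariant mean on } \Gamma\}.$$ A metric space is *proper* if its closed balls are compact, and *geodesic* if any two points are joined by a path whose length (the supremum of $\sum_i d(c(t_{i-1}),c(t_i))$ over all finite partitions) equals their distance. An action of $\Gamma$ on $X$ is *cocompact* if $X/\Gamma$ is compact, and *properly discontinuous* if every point has a neighbourhood $U$ with $gU\cap U=\emptyset$ for all $g\ne e$. **Corollary 3.4.** Let $m\in\mathbb N=\{0,1,2,\dots\}$. (1) Let $(X,d)$ be a proper geodesic metric space on which $\mathbb Z^m$ acts freely, cocompactly and properly discontinuously by isometries. Assume that there is a continuous map $F:X\to\mathbb R^m$ with $F(g.x)=g+F(x)$ for all $g\in\mathbb Z^m$, $x\in X$. Let $x_0\in X$ and define $\ell(g):=d(x_0,g.x_0)$ for $g\in\mathbb Z^m$. Then $\ell$ is a proper length function on $\mathbb Z^m$, and $\mathbb Z^m$ is separated with respect to $\ell$. (2) In particular, let $G$ be a group generated by a finite set $S$ with $S=S^{-1}$, with word length function $\ell_S(g)=\min\{n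 : g=s_1\cdots s_n,\ s_1,\dots,s_n\in S\}$, and suppose that $G$ contains $\mathbb Z^m$ as a normal subgroup of finite index. Then $\mathbb Z^m$ is separated with respect to the restriction $\ell_S|_{\mathbb Z^m}$. -/

import Mathlib

open scoped ENNReal Pointwise Topology ComplexOrder

noncomputable section

namespace LengthGroup

/-! Pseudo-length functions on a group are Mathlib's `GroupSeminorm`s, and length functions are
Mathlib's `GroupNorm`s. -/

/-- The C*-algebra `ℓ^∞(G)` of bounded complex-valued functions on a discrete group. -/
abbrev LInfty (G : Type*) : Type _ := lp (fun _ : G => ℂ) ∞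

variable {G : Type*} [Group G]

/-- The translation action of `G` on `ℓ^∞(G)`: `(g.f)(h) = f(g⁻¹h)`. -/
def translate (g : G) (f : LInfty G) : LInfty G :=
  ⟨fun h => f (g⁻¹ * h), by
    apply memℓp_infty
    obtain ⟨C, hC⟩ := memℓp_infty_iff.mp f.2
    refine ⟨C, ?_⟩
    rintro _ ⟨h, rfl⟩
    exact hC ⟨g⁻¹ * h, rfl⟩⟩

/-- An invariant mean: a state (positive unital linear functional) on `ℓ^∞(G)` that is invariant
under translations. -/
structure IsInvariantMean (μ : LInfty G →ₗ[ℂ] ℂ) : Prop where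
  nonneg : ∀ f : LInfty G, (∀ h, 0 ≤ f h) → 0 ≤ μ f
  map_one : μ 1 = 1
  map_translate : ∀ (g : G) (f : LInfty G), μ (translate g f) = μ f

/-- The bounded function `φ_g^ℓ(h) = ℓ(h) - ℓ(g⁻¹h)`. -/
def cocycle (ℓ : GroupSeminorm G) (g : G) : LInfty G :=
  ⟨fun h => ((ℓ h - ℓ (g⁻¹ * h) : ℝ) : ℂ), by
    apply memℓp_infty
    refine ⟨ℓ g, ?_⟩
    rintro _ ⟨h, rfl⟩
    have h1 : ℓ h ≤ ℓ g + ℓ (g⁻¹ * h) := by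
      simpa using map_mul_le_add ℓ g (g⁻¹ * h)
    have h2 : ℓ (g⁻¹ * h) ≤ ℓ g + ℓ h := by
      simpa using map_mul_le_add ℓ g⁻¹ h
    change ‖((ℓ h - ℓ (g⁻¹ * h) : ℝ) : ℂ)‖ ≤ ℓ g
    rw [Complex.norm_real, Real.norm_eq_abs, abs_le]
    constructor <;> linarith⟩

variable (G) in
/-- The torsion-free component of the Abelianization of `G`. -/
abbrev FreeAbelianPart : Type _ := Abelianization G ⧸ CommGroup.torsion (Abelianization G)

variable (G) in
/-- The (surjective) projection of `G` onto the torsion-free component of its Abelianization. -/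
def proj : G →* FreeAbelianPart G :=
  (QuotientGroup.mk' (CommGroup.torsion (Abelianization G))).comp Abelianization.of

/-- The homomorphisms `im(p_G) → ℝ` of the form `p_G(g) ↦ μ(φ_g^ℓ)` for an invariant mean `μ`. -/
def meanHoms (ℓ : GroupSeminorm G) : Set (Additive (FreeAbelianPart G) →+ ℝ) :=
  {ψ | ∃ μ : LInfty G →ₗ[ℂ] ℂ, IsInvariantMean μ ∧
    ∀ g : G, ((ψ (Additive.ofMul (proj G g)) : ℝ) : ℂ) = μ (cocycle ℓ g)}

/-- A (finitely generated) group `G` is separated with respect to a pseudo-length function `ℓ` if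
the homomorphisms induced by invariant means span the real vector space `Hom(im(p_G), ℝ)`. -/
def IsSeparated (ℓ : GroupSeminorm G) : Prop :=
  Submodule.span ℝ (meanHoms ℓ) = ⊤

/-- A pseudo-length function is proper if its sublevel sets are finite. -/
def IsProperLength (ℓ : GroupSeminorm G) : Prop :=
  ∀ r : ℝ, {g : G | ℓ g ≤ r}.Finite

/-- The word length of `g` with respect to `S`: the least `n` such that `g` is a product of `n`
elements of `S` (meaningful when every element is such a product). -/
def wordLength (S : Set G) (g : G) : ℕ :=
  sInf {n : ℕ | ∃ w : List G, w.length = n ∧ (∀ s ∈ w, s ∈ S) ∧ w.prod = g}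

/-- A metric space is geodesic if any two points are joined by a path whose length (its total
variation) equals their distance. -/
def IsGeodesic (X : Type*) [MetricSpace X] : Prop :=
  ∀ x y : X, ∃ c : Path x y, eVariationOn c Set.univ = edist x y

/-- No non-trivial element of the group fixes a point. -/
def ActsFreely (Γ X : Type*) [AddGroup Γ] [AddAction Γ X] : Prop :=
  ∀ (g : Γ) (x : X), g +ᵥ x = x → g = 0

/-- Each point has a neighbourhood that all non-trivial group elements move outside itself. -/
def ActsProperlyDiscontinuously (Γ X : Type*) [AddGroup Γ] [TopologicalSpace X]
    [AddAction Γ X] : Prop :=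
  ∀ x : X, ∃ U ∈ 𝓝 x, ∀ g : Γ, g ≠ 0 → Disjoint ((fun y => g +ᵥ y) '' U) U

/-- The quotient of the space by the action is compact. -/
def ActsCocompactly (Γ X : Type*) [AddGroup Γ] [TopologicalSpace X] [AddAction Γ X] : Prop :=
  CompactSpace (Quotient (AddAction.orbitRel Γ X))

end LengthGroup

end

/-!
The space `Hom(ℤ^m, ℝ)` is finite-dimensional. If the homomorphisms induced by invariant means do
not span it, then some nonzero `v ∈ ℝ^m` is annihilated by all of them. With `w i = |v i|` and with
`g i` the `i`-th basis vector, up to a sign that matches the sign of `v i`, this says that every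
invariant mean vanishes on the combination `∑ i, w i • φ_{g i}` of cocycles, whose coefficients are
nonnegative. It is thus enough to find an invariant mean that is negative on it
(`exists_isInvariantMean_sum_neg`).

The mean is a limit, along an ultrafilter, of averages over suitable translates of the boxes
`{0, …, n}^m`. By the Følner property such a limit is invariant however the translates are chosen
(`exists_isInvariantMean_tendsto_average`). To choose them, let `A k` be the average of `ℓ` over the
translate by `k` of a fixed box; averaging `φ_{g i}` there gives `A k - A ((g i)⁻¹ * k)`. If the
average of the combination were nowhere clearly negative, then from each `k` some `(g i)⁻¹` would
lead to a point where `A` has grown by at most a small `δ`. In `N` such steps all taken in one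
orthant one gets to distance of order `N` from the origin, whereas `A` has grown by at most `N * δ`.
This is impossible as soon as `ℓ` grows at least linearly (`exists_sum_average_cocycle_lt`).

Both parts are therefore reduced to linear growth of `ℓ` (`isSeparated_of_abs_le`).
* For an orbit in a geodesic space, an equivariant continuous map to `ℝ^m` has bounded variation on
  pairs at distance at most `1`, by cocompactness. Cutting geodesics into pieces of length at most
  `1`, this gives a linear bound (`exists_dist_le_mul_of_equivariant`).
* For word lengths, a subgroup of finite index is undistorted (`exists_le_mul_wordLength`), by
  rewriting words with coset representatives.
-/

noncomputable section

namespace LengthGroup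

open Filter Finset

/-! ### Invariant means from Følner sequences -/

section Means

variable {G : Type*}

@[simp]
lemma translate_apply [Group G] (g : G) (f : LInfty G) (h : G) :
    translate g f h = f (g⁻¹ * h) := rfl

@[simp]
lemma cocycle_apply [Group G] (ℓ : GroupSeminorm G) (g h : G) :
    cocycle ℓ g h = ((ℓ h - ℓ (g⁻¹ * h) : ℝ) : ℂ) := rfl

/-- The functional on `ℓ^∞(G)` that averages over the translate `k * B` of a finite set `B`. -/
def average [Mul G] (B : Finset G) (k : G) : LInfty G →ₗ[ℂ] ℂ where
  toFun f := (#B : ℂ)⁻¹ * ∑ b ∈ B, f (k * b)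
  map_add' f g := by simp [Finset.sum_add_distrib, mul_add]
  map_smul' c f := by simp [← Finset.mul_sum, mul_left_comm]

lemma average_apply [Mul G] (B : Finset G) (k : G) (f : LInfty G) :
    average B k f = (#B : ℂ)⁻¹ * ∑ b ∈ B, f (k * b) := rfl

lemma norm_average_le [Mul G] {B : Finset G} (hB : B.Nonempty) (k : G) (f : LInfty G) :
    ‖average B k f‖ ≤ ‖f‖ := by
  have hpos : (0 : ℝ) < #B := by exact_mod_cast hB.card_pos
  rw [average_apply, norm_mul, norm_inv, Complex.norm_natCast, inv_mul_le_iff₀ hpos]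
  refine (norm_sum_le _ _).trans ?_
  simpa using Finset.sum_le_card_nsmul B _ ‖f‖
    fun b _ => lp.norm_apply_le_norm ENNReal.top_ne_zero f (k * b)

/-- An averaging functional is invariant under the translation by `g` up to the proportion of the
averaging set that `g⁻¹` moves outside of it. -/
lemma norm_average_translate_sub_le [CommGroup G] [DecidableEq G] (B : Finset G) (k g : G)
    (f : LInfty G) :
    ‖average B k (translate g f) - average B k f‖
      ≤ 2 * ‖f‖ * ((#(B.map (Equiv.mulLeft g⁻¹).toEmbedding \ B) : ℝ) / #B) := by
  set C := B.map (Equiv.mulLeft g⁻¹).toEmbedding with hC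
  have hsum : ∑ b ∈ B, translate g f (k * b) = ∑ b ∈ C, f (k * b) := by
    rw [hC, Finset.sum_map]
    exact Finset.sum_congr rfl fun b _ => by simp [mul_left_comm]
  have hcard : #(B \ C) = #(C \ B) := Finset.card_sdiff_comm (by simp [hC])
  have hbound (D : Finset G) : ‖∑ b ∈ D, f (k * b)‖ ≤ #D * ‖f‖ := by
    refine (norm_sum_le _ _).trans ?_
    simpa using Finset.sum_le_card_nsmul D _ ‖f‖
      fun b _ => lp.norm_apply_le_norm ENNReal.top_ne_zero f (k * b)
  have hdiff : ‖∑ b ∈ C, f (k * b) - ∑ b ∈ B, f (k * b)‖ ≤ 2 * ‖f‖ * #(C \ B) := by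
    rw [← Finset.sum_sdiff_sub_sum_sdiff]
    refine (norm_sub_le _ _).trans ?_
    have h1 := hbound (C \ B)
    have h2 := hbound (B \ C)
    rw [hcard] at h2
    linarith
  rw [average_apply, average_apply, hsum, ← mul_sub, norm_mul, norm_inv, Complex.norm_natCast,
    mul_div_assoc', div_eq_inv_mul]
  gcongr

/-- Averaging over arbitrary translates of the members of a Følner sequence gives, in the limit
along an ultrafilter, an invariant mean. -/
theorem exists_isInvariantMean_tendsto_average [CommGroup G] [DecidableEq G] {B : ℕ → Finset G}
    (hB : ∀ n, (B n).Nonempty)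
    (hF : ∀ g : G, Tendsto
      (fun n => (#((B n).map (Equiv.mulLeft g).toEmbedding \ B n) : ℝ) / #(B n)) atTop (𝓝 0))
    (k : ℕ → G) :
    ∃ μ : LInfty G →ₗ[ℂ] ℂ, IsInvariantMean μ ∧
      ∀ f, Tendsto (fun n => average (B n) (k n) f) (hyperfilter ℕ) (𝓝 (μ f)) := by
  have hlim (f : LInfty G) :
      ∃ z, Tendsto (fun n => average (B n) (k n) f) (hyperfilter ℕ) (𝓝 z) := by
    obtain ⟨z, -, hz⟩ := (isCompact_closedBall (0 : ℂ) ‖f‖).ultrafilter_le_nhds'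
      ((hyperfilter ℕ).map fun n => average (B n) (k n) f)
      (Filter.mem_map.2 <| Filter.univ_mem' fun n => by
        simpa using norm_average_le (hB n) (k n) f)
    exact ⟨z, hz⟩
  choose L hL using hlim
  refine ⟨⟨⟨L, fun f g => ?_⟩, fun c f => ?_⟩, ⟨fun f hf => ?_, ?_, fun g f => ?_⟩, hL⟩
  · refine tendsto_nhds_unique (hL (f + g)) ?_
    simpa only [map_add] using (hL f).add (hL g)
  · refine tendsto_nhds_unique (hL (c • f)) ?_
    simpa only [map_smul, RingHom.id_apply] using (hL f).const_smul c
  · refine ge_of_tendsto' (hL f) fun n => ?_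
    have h0 : (0 : ℂ) ≤ (#(B n) : ℂ)⁻¹ := by
      rw [← Complex.ofReal_natCast, ← Complex.ofReal_inv]
      exact Complex.zero_le_real.2 (by positivity)
    exact mul_nonneg h0 (Finset.sum_nonneg fun b _ => hf _)
  · refine tendsto_nhds_unique (hL 1) (tendsto_const_nhds.congr fun n => ?_)
    have h0 : (#(B n) : ℂ) ≠ 0 := by exact_mod_cast (hB n).card_pos.ne'
    simp [average_apply, h0]
  · have h0 : Tendsto (fun n => average (B n) (k n) (translate g f) - average (B n) (k n) f)
        (hyperfilter ℕ) (𝓝 0) := by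
      refine squeeze_zero_norm (fun n => norm_average_translate_sub_le (B n) (k n) g f) ?_
      simpa using ((hF g⁻¹).const_mul (2 * ‖f‖)).mono_left Nat.hyperfilter_le_atTop
    exact sub_eq_zero.1 (tendsto_nhds_unique ((hL (translate g f)).sub (hL f)) h0)

end Means

/-! ### The homomorphism induced by an invariant mean -/

section Hom

variable {G : Type*} [Group G] {μ : LInfty G →ₗ[ℂ] ℂ}

lemma cocycle_mul (ℓ : GroupSeminorm G) (g h : G) :
    cocycle ℓ (g * h) = cocycle ℓ g + translate g (cocycle ℓ h) := by
  ext x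
  simp [mul_assoc]

lemma IsInvariantMean.map_cocycle_mul (hμ : IsInvariantMean μ) (ℓ : GroupSeminorm G) (g h : G) :
    μ (cocycle ℓ (g * h)) = μ (cocycle ℓ g) + μ (cocycle ℓ h) := by
  rw [cocycle_mul, map_add, hμ.map_translate]

lemma IsInvariantMean.map_cocycle_im (hμ : IsInvariantMean μ) (ℓ : GroupSeminorm G) (g : G) :
    (μ (cocycle ℓ g)).im = 0 := by
  -- a mean is only assumed to be real on nonnegative functions: shift the cocycle by a constant
  have h := hμ.nonneg (cocycle ℓ g + (ℓ g : ℂ) • (1 : LInfty G)) fun x => by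
    have h1 : ℓ (g⁻¹ * x) ≤ ℓ g + ℓ x := by simpa using map_mul_le_add ℓ g⁻¹ x
    have h2 : (cocycle ℓ g + (ℓ g : ℂ) • (1 : LInfty G)) x
        = ((ℓ x - ℓ (g⁻¹ * x) + ℓ g : ℝ) : ℂ) := by
      change cocycle ℓ g x + (ℓ g : ℂ) * 1 = _
      simp
    rw [h2]
    exact Complex.zero_le_real.2 (by linarith)
  rw [map_add, map_smul, hμ.map_one] at h
  simpa using (Complex.le_def.1 h).2.symm

lemma proj_surjective : Function.Surjective (proj G) :=
  (QuotientGroup.mk'_surjective _).comp (QuotientGroup.mk'_surjective _)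

/-- Every homomorphism to the reals factors through the torsion-free component of the
Abelianization. -/
lemma exists_comp_proj_eq (φ : G →* Multiplicative ℝ) :
    ∃ ψ : Additive (FreeAbelianPart G) →+ ℝ, ∀ g, ψ (Additive.ofMul (proj G g)) = (φ g).toAdd := by
  have hker : CommGroup.torsion (Abelianization G) ≤ (Abelianization.lift φ).ker := by
    intro a ha
    obtain ⟨n, hn, hna⟩ := isOfFinOrder_iff_pow_eq_one.1 ha
    have h : n • (Abelianization.lift φ a).toAdd = 0 := by
      rw [← toAdd_pow, ← map_pow, hna, map_one, toAdd_one]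
    exact (smul_eq_zero.1 h).resolve_left hn.ne'
  exact ⟨MonoidHom.toAdditiveLeft (QuotientGroup.lift _ (Abelianization.lift φ) hker),
    fun g => rfl⟩

/-- The homomorphism on the torsion-free component of the Abelianization that an invariant mean
induces. -/
lemma IsInvariantMean.exists_meanHoms (hμ : IsInvariantMean μ) (ℓ : GroupSeminorm G) :
    ∃ ψ ∈ meanHoms ℓ, ∀ g : G, ψ (Additive.ofMul (proj G g)) = (μ (cocycle ℓ g)).re := by
  obtain ⟨ψ, hψ⟩ := exists_comp_proj_eq (G := G) (MonoidHom.mk'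
    (fun g => Multiplicative.ofAdd (μ (cocycle ℓ g)).re)
    fun g h => by rw [hμ.map_cocycle_mul, Complex.add_re, ofAdd_add])
  refine ⟨ψ, ⟨μ, hμ, fun g => ?_⟩, hψ⟩
  rw [hψ]
  exact Complex.ext rfl (hμ.map_cocycle_im ℓ g).symm

end Hom

/-! ### A mean that detects a direction -/

section Direction

variable {G : Type*} [CommGroup G] {ι : Type*} [Fintype ι]

/-- If the weighted mean growth of `ℓ` along the `g i` were everywhere small, then, walking along
the inverses of the `g i` and always choosing a direction in which the averaged length grows slowly,
one would reach points of small length far away from the origin. Distance is measured here by a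
homomorphism `χ` that drops by `1` in each step and is dominated by `ℓ`. -/
lemma exists_sum_average_cocycle_lt {B : Finset G} (hB : B.Nonempty) (ℓ : GroupSeminorm G)
    {w : ι → ℝ} (hw : ∀ i, 0 ≤ w i) (hw' : ∃ i, w i ≠ 0) {g : ι → G} {χ : G →* Multiplicative ℝ}
    (hg : ∀ i, (χ (g i)).toAdd = 1) {L : ℝ} (hχ : ∀ k, |(χ k).toAdd| ≤ L * (ℓ k + 1)) {δ : ℝ}
    (hδ : L * δ < 1) :
    ∃ k : G, ∑ i, w i * (average B k (cocycle ℓ (g i))).re < -δ * ∑ i, w i := by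
  by_contra! hcon
  have hpos : (0 : ℝ) < #B := by exact_mod_cast hB.card_pos
  set A : G → ℝ := fun k => (#B : ℝ)⁻¹ * ∑ b ∈ B, ℓ (k * b) with hA
  have hre (k : G) (i : ι) : (average B k (cocycle ℓ (g i))).re = A k - A ((g i)⁻¹ * k) := by
    have h : average B k (cocycle ℓ (g i)) = ((A k - A ((g i)⁻¹ * k) : ℝ) : ℂ) := by
      simp [average_apply, hA, ← mul_sub, mul_assoc]
    rw [h, Complex.ofReal_re]
  have hstep (k : G) : ∃ i, A ((g i)⁻¹ * k) ≤ A k + δ := by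
    by_contra! hk
    have h1 : ∑ i, w i * (average B k (cocycle ℓ (g i))).re < ∑ i, w i * -δ := by
      obtain ⟨j, hj⟩ := hw'
      refine Finset.sum_lt_sum (fun i _ => ?_) ⟨j, Finset.mem_univ _, ?_⟩
      · rw [hre]
        exact mul_le_mul_of_nonneg_left (by linarith [hk i]) (hw i)
      · rw [hre]
        exact mul_lt_mul_of_pos_left (by linarith [hk j]) ((hw j).lt_of_ne' hj)
    rw [← Finset.sum_mul, mul_comm] at h1
    exact absurd h1 (hcon k).not_gt
  have hwalk (N : ℕ) : ∃ k : G, A k ≤ A 1 + N * δ ∧ (χ k).toAdd = -N := by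
    induction N with
    | zero => exact ⟨1, by simp, by simp⟩
    | succ N ih =>
      obtain ⟨k, hk, hk'⟩ := ih
      obtain ⟨i, hi⟩ := hstep k
      refine ⟨(g i)⁻¹ * k, ?_, ?_⟩
      · push_cast
        linarith
      · rw [map_mul, map_inv, toAdd_mul, toAdd_inv, hg, hk']
        push_cast
        ring
  have hlower (k : G) : ℓ k ≤ A k + A 1 := by
    have h : ∑ _b ∈ B, ℓ k ≤ ∑ b ∈ B, (ℓ (k * b) + ℓ (1 * b)) := by
      refine Finset.sum_le_sum fun b _ => ?_
      simpa using map_mul_le_add ℓ (k * b) b⁻¹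
    rw [Finset.sum_const, nsmul_eq_mul, Finset.sum_add_distrib] at h
    rw [hA, ← mul_add, inv_mul_eq_div, le_div_iff₀ hpos]
    linarith
  have hL : 0 ≤ L := by
    have := (abs_nonneg _).trans (hχ 1)
    simpa using this
  obtain ⟨N, hN⟩ := exists_nat_gt (L * (2 * A 1 + 1) / (1 - L * δ))
  rw [div_lt_iff₀ (by linarith)] at hN
  obtain ⟨k, hk, hk'⟩ := hwalk N
  have h1 := hχ k
  rw [hk', abs_neg, Nat.abs_cast] at h1
  have h2 : L * (ℓ k + 1) ≤ L * (2 * A 1 + N * δ + 1) :=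
    mul_le_mul_of_nonneg_left (by linarith [hlower k]) hL
  linarith

/-- A mean on which a nonzero nonnegative combination of the cocycles `φ_{g i}` does not vanish:
average over translates, along a Følner sequence, on which this combination is negative. -/
theorem exists_isInvariantMean_sum_neg [DecidableEq G] {B : ℕ → Finset G}
    (hB : ∀ n, (B n).Nonempty)
    (hF : ∀ g : G, Tendsto
      (fun n => (#((B n).map (Equiv.mulLeft g).toEmbedding \ B n) : ℝ) / #(B n)) atTop (𝓝 0))
    (ℓ : GroupSeminorm G) {w : ι → ℝ} (hw : ∀ i, 0 ≤ w i) (hw' : ∃ i, w i ≠ 0) {g : ι → G}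
    {χ : G →* Multiplicative ℝ} (hg : ∀ i, (χ (g i)).toAdd = 1) {L : ℝ}
    (hχ : ∀ k, |(χ k).toAdd| ≤ L * (ℓ k + 1)) :
    ∃ μ : LInfty G →ₗ[ℂ] ℂ, IsInvariantMean μ ∧
      ∑ i, w i * (μ (cocycle ℓ (g i))).re < 0 := by
  obtain ⟨δ, hδ, hLδ⟩ : ∃ δ : ℝ, 0 < δ ∧ L * δ < 1 := by
    refine ⟨(|L| + 1)⁻¹, by positivity, ?_⟩
    rw [← div_eq_mul_inv, div_lt_one (by positivity)]
    linarith [le_abs_self L]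
  choose k hk using fun n => exists_sum_average_cocycle_lt (hB n) ℓ hw hw' hg hχ hLδ
  obtain ⟨μ, hμ, hlim⟩ := exists_isInvariantMean_tendsto_average hB hF k
  refine ⟨μ, hμ, ?_⟩
  have hsum : 0 < ∑ i, w i := by
    obtain ⟨j, hj⟩ := hw'
    exact Finset.sum_pos' (fun i _ => hw i) ⟨j, Finset.mem_univ _, (hw j).lt_of_ne' hj⟩
  have h : Tendsto (fun n => ∑ i, w i * (average (B n) (k n) (cocycle ℓ (g i))).re)
      (hyperfilter ℕ) (𝓝 (∑ i, w i * (μ (cocycle ℓ (g i))).re)) :=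
    tendsto_finsetSum _ fun i _ =>
      ((Complex.continuous_re.tendsto _).comp (hlim (cocycle ℓ (g i)))).const_mul _
  have h' := le_of_tendsto' h fun n => (hk n).le
  nlinarith

end Direction

/-! ### Separation for free Abelian groups -/

section FreeAbelian

variable {m : ℕ}

/-- The boxes `{0, …, n}^m` in `ℤ^m`. -/
def box (m n : ℕ) : Finset (Multiplicative (Fin m → ℤ)) :=
  (Fintype.piFinset fun _ => Finset.Ico (0 : ℤ) (n + 1)).map Multiplicative.ofAdd.toEmbedding

lemma mem_box {n : ℕ} {x : Multiplicative (Fin m → ℤ)} :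
    x ∈ box m n ↔ ∀ i, 0 ≤ x.toAdd i ∧ x.toAdd i < n + 1 := by
  simp [box]

lemma card_box (m n : ℕ) : #(box m n) = (n + 1) ^ m := by
  simp only [box, Finset.card_map, Fintype.card_piFinset, Int.card_Ico, Finset.prod_const,
    Finset.card_univ, Fintype.card_fin]
  congr 1

lemma box_nonempty (m n : ℕ) : (box m n).Nonempty :=
  Finset.card_pos.1 (by rw [card_box]; positivity)

lemma box_inter_map_mulLeft (n : ℕ) (g : Multiplicative (Fin m → ℤ)) :
    box m n ∩ (box m n).map (Equiv.mulLeft g).toEmbedding =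
      (Fintype.piFinset fun i => Finset.Ico (max 0 (g.toAdd i))
        (min (n + 1 : ℤ) (n + 1 + g.toAdd i))).map Multiplicative.ofAdd.toEmbedding := by
  ext x
  simp only [Finset.mem_inter, Finset.mem_map_equiv, Equiv.mulLeft_symm_apply, mem_box,
    Fintype.mem_piFinset, Finset.mem_Ico, Multiplicative.ofAdd_symm_eq, toAdd_mul, toAdd_inv,
    Pi.add_apply, Pi.neg_apply, ← forall_and]
  refine forall_congr' fun i => ?_
  grind

/-- The boxes form a Følner sequence: the translate of a box by `g` meets the box in a box with
sides shortened by the coordinates of `g`. -/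
lemma tendsto_card_box_sdiff (g : Multiplicative (Fin m → ℤ)) :
    Tendsto (fun n => (#((box m n).map (Equiv.mulLeft g).toEmbedding \ box m n) : ℝ) / #(box m n))
      atTop (𝓝 0) := by
  have hform (n : ℕ) :
      (#((box m n).map (Equiv.mulLeft g).toEmbedding \ box m n) : ℝ) / #(box m n)
        = 1 - ∏ i, max (1 - |(g.toAdd i : ℝ)| * ((n : ℝ) + 1)⁻¹) 0 := by
    have hn : (0 : ℝ) < (n : ℝ) + 1 := by positivity
    have hside (i : Fin m) : ((min (n + 1 : ℤ) (n + 1 + g.toAdd i) - max 0 (g.toAdd i)).toNat : ℝ)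
        = ((n : ℝ) + 1) * max (1 - |(g.toAdd i : ℝ)| * ((n : ℝ) + 1)⁻¹) 0 := by
      have h : min (n + 1 : ℤ) (n + 1 + g.toAdd i) - max 0 (g.toAdd i)
          = n + 1 - |g.toAdd i| := by grind
      rw [h, ← Int.cast_natCast, Int.toNat_eq_max, Int.cast_max, mul_max_of_nonneg _ _ hn.le]
      push_cast
      congr 1
      · field_simp
      · simp
    have hinter : (#(box m n ∩ (box m n).map (Equiv.mulLeft g).toEmbedding) : ℝ)
        = #(box m n) * ∏ i, max (1 - |(g.toAdd i : ℝ)| * ((n : ℝ) + 1)⁻¹) 0 := by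
      rw [box_inter_map_mulLeft, Finset.card_map, Fintype.card_piFinset]
      simp only [Int.card_Ico]
      rw [Nat.cast_prod, Finset.prod_congr rfl fun i _ => hside i, Finset.prod_mul_distrib,
        card_box]
      simp
    have hsplit : (#((box m n).map (Equiv.mulLeft g).toEmbedding \ box m n) : ℝ)
        + #(box m n ∩ (box m n).map (Equiv.mulLeft g).toEmbedding) = #(box m n) := by
      rw [Finset.inter_comm]
      exact_mod_cast (Finset.card_sdiff_add_card_inter _ _).trans (Finset.card_map _)
    have hpos : (#(box m n) : ℝ) ≠ 0 := by exact_mod_cast (box_nonempty m n).card_pos.ne'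
    rw [div_eq_iff hpos]
    linarith
  simp only [hform]
  have hinv : Tendsto (fun n : ℕ => ((n : ℝ) + 1)⁻¹) atTop (𝓝 0) := by
    simpa using tendsto_one_div_add_atTop_nhds_zero_nat (𝕜 := ℝ)
  have hprod : Tendsto (fun n : ℕ => ∏ i, max (1 - |(g.toAdd i : ℝ)| * ((n : ℝ) + 1)⁻¹) 0)
      atTop (𝓝 (∏ _i : Fin m, 1)) := by
    refine tendsto_finsetProd _ fun i _ => ?_
    simpa using ((hinv.const_mul |(g.toAdd i : ℝ)|).const_sub 1).max
      (tendsto_const_nhds (x := (0 : ℝ)))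
  simpa using hprod.const_sub 1

lemma isProperLength_of_abs_le (ℓ : GroupSeminorm (Multiplicative (Fin m → ℤ))) {L : ℝ}
    (hL : ∀ (g : Fin m → ℤ) (i : Fin m), |(g i : ℝ)| ≤ L * (ℓ (Multiplicative.ofAdd g) + 1)) :
    IsProperLength ℓ := by
  intro r
  have hfin : {g : Fin m → ℤ | ∀ i, g i ∈ Set.Icc (-⌊L * (r + 1)⌋) ⌊L * (r + 1)⌋}.Finite :=
    Set.Finite.pi' fun _ => Set.finite_Icc _ _
  refine hfin.subset fun (g : Fin m → ℤ) (hg : ℓ (Multiplicative.ofAdd g) ≤ r) i => ?_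
  have hL0 : 0 ≤ L := by simpa using (abs_nonneg _).trans (hL 0 i)
  have h : |(g i : ℝ)| ≤ L * (r + 1) :=
    (hL g i).trans (mul_le_mul_of_nonneg_left (by linarith) hL0)
  rw [← Int.cast_abs] at h
  exact abs_le.1 (Int.le_floor.2 h)

/-- A seminorm on `ℤ^m` that grows at least linearly is separating: otherwise a nonzero vector `v`
would be annihilated by all induced homomorphisms, that is, the cocycles of the generators, with
signs chosen according to `v`, would have a nonzero combination with nonnegative coefficients in the
kernel of all invariant means. -/
theorem isSeparated_of_abs_le (ℓ : GroupSeminorm (Multiplicative (Fin m → ℤ))) {L : ℝ}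
    (hL : ∀ (g : Fin m → ℤ) (i : Fin m), |(g i : ℝ)| ≤ L * (ℓ (Multiplicative.ofAdd g) + 1)) :
    IsSeparated ℓ := by
  let Γ := Multiplicative (Fin m → ℤ)
  let e (i : Fin m) : Γ := Multiplicative.ofAdd (Pi.single i 1)
  -- a homomorphism is determined by its values on the standard basis
  let ev : (Additive (FreeAbelianPart Γ) →+ ℝ) →ₗ[ℝ] (Fin m → ℝ) :=
    { toFun := fun ψ i => ψ (Additive.ofMul (proj Γ (e i)))
      map_add' := fun _ _ => rfl
      map_smul' := fun _ _ => rfl }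
  have hev : Function.Injective ev := by
    intro ψ ψ' h
    let p : (Fin m → ℤ) →+ Additive (FreeAbelianPart Γ) := MonoidHom.toAdditiveRight (proj Γ)
    have hp : ψ.comp p = ψ'.comp p := by
      refine AddMonoidHom.functions_ext' _ _ _ fun i => AddMonoidHom.ext_int ?_
      exact congrFun h i
    refine AddMonoidHom.ext fun a => ?_
    obtain ⟨g, hg⟩ := proj_surjective (G := Γ) a.toMul
    have := DFunLike.congr_fun hp g.toAdd
    have hpa : p g.toAdd = a := by
      change Additive.ofMul (proj Γ g) = a
      rw [hg, ofMul_toMul]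
    rwa [AddMonoidHom.comp_apply, AddMonoidHom.comp_apply, hpa] at this
  by_contra hsep
  obtain ⟨ψ₀, -, hψ₀⟩ := SetLike.exists_of_lt (lt_top_iff_ne_top.2 hsep)
  obtain ⟨d, hd, hd'⟩ := Submodule.exists_dual_map_eq_bot_of_notMem
    (p := (Submodule.span ℝ (meanHoms ℓ)).map ev) (x := ev ψ₀)
    (fun h => by
      obtain ⟨ψ, hψ, h⟩ := h
      exact hψ₀ (hev h ▸ hψ)) inferInstance
  let v (i : Fin m) : ℝ := d (Pi.single i 1)
  have hdv (x : Fin m → ℝ) : d x = ∑ i, v i * x i := by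
    conv_lhs => rw [← Finset.univ_sum_single x, map_sum]
    refine Finset.sum_congr rfl fun i _ => ?_
    rw [mul_comm, ← smul_eq_mul, ← map_smul, ← Pi.single_smul, smul_eq_mul, mul_one]
  have hv : ∃ i, |v i| ≠ 0 := by
    by_contra! h
    exact hd (by simp [hdv, fun i => abs_eq_zero.1 (h i)])
  let s (i : Fin m) : ℤ := if 0 ≤ v i then 1 else -1
  have hs (i : Fin m) : |v i| * s i = v i := by
    by_cases h : 0 ≤ v i
    · simp [s, h]
    · simp [s, h, abs_of_neg (not_le.1 h)]
  have hs' (i : Fin m) : (s i : ℝ) * s i = 1 := by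
    by_cases h : 0 ≤ v i <;> simp [s, h]
  have hs1 (i : Fin m) : |(s i : ℝ)| = 1 := by
    by_cases h : 0 ≤ v i <;> simp [s, h]
  let χ : (Fin m → ℤ) →+ ℝ := AddMonoidHom.mk' (fun g => ∑ i, (s i : ℝ) * (g i : ℝ)) fun g h => by
    simp [mul_add, Finset.sum_add_distrib]
  have hχ (k : Γ) : |χ k.toAdd| ≤ (m * L) * (ℓ k + 1) := by
    change |∑ i, (s i : ℝ) * (k.toAdd i : ℝ)| ≤ _
    calc |∑ i, (s i : ℝ) * (k.toAdd i : ℝ)| ≤ ∑ i, |(s i : ℝ) * (k.toAdd i : ℝ)| :=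
          Finset.abs_sum_le_sum_abs _ _
      _ ≤ ∑ _i : Fin m, L * (ℓ k + 1) := Finset.sum_le_sum fun i _ => by
          rw [abs_mul, hs1, one_mul]
          exact hL k.toAdd i
      _ = (m * L) * (ℓ k + 1) := by simp [mul_assoc]
  have hg (i : Fin m) : χ (s i • Pi.single i 1) = 1 := by
    have h : χ (Pi.single i 1) = s i := by
      simp [χ, Pi.single_apply]
    rw [map_zsmul, h, zsmul_eq_mul, hs']
  obtain ⟨μ, hμ, hneg⟩ := exists_isInvariantMean_sum_neg (box_nonempty m) tendsto_card_box_sdiff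
    ℓ (w := fun i => |v i|) (fun i => abs_nonneg _) hv (g := fun i => e i ^ s i)
    (χ := AddMonoidHom.toMultiplicative χ) hg hχ
  obtain ⟨ψ, hψ, hψμ⟩ := hμ.exists_meanHoms ℓ
  have hzero : d (ev ψ) = 0 := by
    have : d (ev ψ) ∈ ((Submodule.span ℝ (meanHoms ℓ)).map ev).map d :=
      ⟨_, ⟨_, Submodule.subset_span hψ, rfl⟩, rfl⟩
    rwa [hd', Submodule.mem_bot] at this
  refine hneg.ne ?_
  rw [← hzero, hdv]
  refine Finset.sum_congr rfl fun i _ => ?_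
  rw [← hψμ, map_zpow, ofMul_zpow, map_zsmul, zsmul_eq_mul, ← mul_assoc, hs]
  rfl

end FreeAbelian

/-! ### Large-scale Lipschitz maps and orbits -/

section Orbit

variable {X : Type*} [MetricSpace X]

lemma IsGeodesic.exists_dist_eq (hX : IsGeodesic X) {x y : X} {t : ℝ} (h0 : 0 ≤ t)
    (ht : t ≤ dist x y) : ∃ z, dist x z = t ∧ dist x z + dist z y ≤ dist x y := by
  obtain ⟨c, hc⟩ := hX x y
  obtain ⟨s, hs⟩ := mem_range_of_exists_le_of_exists_ge (f := fun s => dist x (c s)) (c := t)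
    (by fun_prop) ⟨0, by simpa using h0⟩ ⟨1, by simpa using ht⟩
  refine ⟨c s, hs, ?_⟩
  have h1 : edist x (c s) ≤ eVariationOn c (Set.Iic s) := by
    simpa using eVariationOn.edist_le c (s := Set.Iic s) (x := 0) (y := s)
      (Set.mem_Iic.2 s.2.1) Set.self_mem_Iic
  have h2 : edist (c s) y ≤ eVariationOn c (Set.Ici s) := by
    simpa using eVariationOn.edist_le c (s := Set.Ici s) (x := s) (y := 1)
      Set.self_mem_Ici (Set.mem_Ici.2 s.2.2)
  have h3 := (add_le_add h1 h2).trans ((eVariationOn.add_le_union c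
    fun a ha b hb => (Set.mem_Iic.1 ha).trans (Set.mem_Ici.1 hb)).trans
      ((eVariationOn.mono c (Set.subset_univ _)).trans_eq hc))
  rw [edist_dist, edist_dist, edist_dist, ← ENNReal.ofReal_add dist_nonneg dist_nonneg] at h3
  exact (ENNReal.ofReal_le_ofReal_iff dist_nonneg).1 h3

/-- In a geodesic space, bounded variation at scale `1` implies a linear bound at all scales. -/
lemma IsGeodesic.dist_le_mul (hX : IsGeodesic X) {E : Type*} [PseudoMetricSpace E] {F : X → E}
    {C : ℝ} (hF : ∀ x y, dist x y ≤ 1 → dist (F x) (F y) ≤ C) (x y : X) :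
    dist (F x) (F y) ≤ C * (dist x y + 1) := by
  have hC : 0 ≤ C := dist_nonneg.trans (hF x x (by simp))
  have key (N : ℕ) : ∀ x, dist x y ≤ N → dist (F x) (F y) ≤ C * N := by
    induction N with
    | zero =>
      intro x h
      have hxy : x = y := dist_le_zero.1 (by simpa using h)
      simp [hxy]
    | succ N ih =>
      intro x h
      push_cast at h ⊢
      rcases le_total (dist x y) 1 with h1 | h1
      · have h2 : 0 ≤ C * N := by positivity
        linarith [hF x y h1]
      · obtain ⟨z, hz, hz'⟩ := hX.exists_dist_eq zero_le_one h1
        linarith [dist_triangle (F x) (F z) (F y), hF x z hz.le, ih z (by linarith)]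
  refine (key _ x (Nat.le_ceil _)).trans ?_
  gcongr
  exact (Nat.ceil_lt_add_one dist_nonneg).le

/-- A cocompact isometric action has a ball that meets every orbit. -/
lemma ActsCocompactly.exists_dist_le {Γ : Type*} [AddGroup Γ] [AddAction Γ X]
    [IsIsometricVAdd Γ X] (h : ActsCocompactly Γ X) (x₀ : X) :
    ∃ R : ℝ, ∀ x : X, ∃ g : Γ, dist x₀ (g +ᵥ x) ≤ R := by
  have : CompactSpace (Quotient (AddAction.orbitRel Γ X)) := h
  let π : X → Quotient (AddAction.orbitRel Γ X) := Quotient.mk _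
  have hopen : IsOpenMap π := isOpenMap_quotient_mk'_add
  obtain ⟨N, hN⟩ := (isCompact_univ (X := Quotient (AddAction.orbitRel Γ X))).elim_directed_cover
    (fun N : ℕ => π '' Metric.ball x₀ N) (fun N => hopen _ Metric.isOpen_ball)
    (fun q _ => by
      obtain ⟨x, rfl⟩ := Quotient.exists_rep q
      obtain ⟨N, hN⟩ := exists_nat_gt (dist x x₀)
      exact Set.mem_iUnion.2 ⟨N, x, hN, rfl⟩)
    (directed_of_isDirected_le fun a b hab =>
      Set.image_mono (Metric.ball_subset_ball (by exact_mod_cast hab)))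
  refine ⟨N, fun x => ?_⟩
  obtain ⟨y, hy, hyx⟩ := hN (Set.mem_univ (π x))
  obtain ⟨g, hg⟩ := Quotient.exact hyx
  refine ⟨g, ?_⟩
  have hg' : g +ᵥ x = y := hg
  rw [hg', dist_comm]
  exact (Metric.mem_ball.1 hy).le

/-- An equivariant continuous map on a proper geodesic space with a cocompact isometric action is
Lipschitz on large scales. -/
lemma exists_dist_le_mul_of_equivariant [ProperSpace X] {Γ : Type*} [AddGroup Γ] [AddAction Γ X]
    [IsIsometricVAdd Γ X] (hX : IsGeodesic X) (hc : ActsCocompactly Γ X) {E : Type*}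
    [SeminormedAddCommGroup E] {F : X → E} (hF : Continuous F) {j : Γ → E}
    (hj : ∀ g x, F (g +ᵥ x) = j g + F x) :
    ∃ L : ℝ, ∀ x y, dist (F x) (F y) ≤ L * (dist x y + 1) := by
  rcases isEmpty_or_nonempty X with hX' | ⟨⟨x₀⟩⟩
  · exact ⟨0, fun x => (IsEmpty.false x).elim⟩
  obtain ⟨R, hR⟩ := hc.exists_dist_le x₀
  obtain ⟨C, hC⟩ := Metric.isBounded_iff.1
    ((isCompact_closedBall x₀ (R + 1)).image hF).isBounded
  refine ⟨C, hX.dist_le_mul fun x y hxy => ?_⟩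
  obtain ⟨g, hg⟩ := hR x
  have hmem (z : X) (hz : dist x₀ (g +ᵥ z) ≤ R + 1) :
      F (g +ᵥ z) ∈ F '' Metric.closedBall x₀ (R + 1) :=
    Set.mem_image_of_mem F (by rwa [Metric.mem_closedBall, dist_comm])
  have hy : dist x₀ (g +ᵥ y) ≤ R + 1 := by
    have := dist_triangle x₀ (g +ᵥ x) (g +ᵥ y)
    rw [dist_vadd] at this
    linarith
  have h := hC (hmem x (by linarith)) (hmem y hy)
  rwa [hj, hj, dist_add_left] at h

/-- The displacement of a base point under a free isometric action, as a length function. -/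
def orbitNorm {Γ : Type*} [AddGroup Γ] [AddAction Γ X] [IsIsometricVAdd Γ X]
    (hfree : ActsFreely Γ X) (x₀ : X) : GroupNorm (Multiplicative Γ) where
  toFun g := dist x₀ (g.toAdd +ᵥ x₀)
  map_one' := by simp
  mul_le' g h := by
    have := dist_triangle x₀ (g.toAdd +ᵥ x₀) (g.toAdd +ᵥ h.toAdd +ᵥ x₀)
    rwa [dist_vadd, vadd_vadd] at this
  inv' g := by
    rw [toAdd_inv, ← dist_vadd g.toAdd x₀, vadd_neg_vadd, dist_comm]
  eq_one_of_map_eq_zero' g h := toAdd_eq_zero.1 (hfree _ x₀ (dist_eq_zero.1 h).symm)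

end Orbit

/-! ### Word lengths -/

section Word

variable {G : Type*} [Group G] {S : Set G}

lemma wordLength_le {w : List G} (hw : ∀ s ∈ w, s ∈ S) : wordLength S w.prod ≤ w.length :=
  Nat.sInf_le ⟨w, rfl, hw, rfl⟩

lemma exists_word (hS : S = S⁻¹) (hgen : Subgroup.closure S = ⊤) (g : G) :
    ∃ w : List G, w.length = wordLength S g ∧ (∀ s ∈ w, s ∈ S) ∧ w.prod = g := by
  refine Nat.sInf_mem (s := {n | ∃ w : List G, w.length = n ∧ (∀ s ∈ w, s ∈ S) ∧ w.prod = g}) ?_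
  have hg : g ∈ Submonoid.closure S := by
    have h : g ∈ (Subgroup.closure S).toSubmonoid := by simp [hgen]
    rwa [Subgroup.closure_toSubmonoid, ← hS, Set.union_self] at h
  obtain ⟨w, hw, rfl⟩ := Submonoid.exists_list_of_mem_closure hg
  exact ⟨_, w, rfl, hw, rfl⟩

lemma wordLength_inv_le (hS : S = S⁻¹) (hgen : Subgroup.closure S = ⊤) (g : G) :
    wordLength S g⁻¹ ≤ wordLength S g := by
  obtain ⟨w, hw, hwS, rfl⟩ := exists_word hS hgen g
  rw [List.prod_inv_reverse, ← hw]
  refine (wordLength_le fun s hs => ?_).trans_eq (by simp)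
  rw [List.mem_reverse, List.mem_map] at hs
  obtain ⟨t, ht, rfl⟩ := hs
  rw [hS]
  exact Set.inv_mem_inv.2 (hwS t ht)

/-- The word length with respect to a symmetric generating set, as a length function. -/
def wordNorm (hS : S = S⁻¹) (hgen : Subgroup.closure S = ⊤) : GroupNorm G where
  toFun g := wordLength S g
  map_one' := by
    have h : wordLength S (1 : G) ≤ 0 := wordLength_le (w := []) (by simp)
    exact_mod_cast Nat.le_zero.1 h
  mul_le' g h := by
    obtain ⟨w, hw, hwS, rfl⟩ := exists_word hS hgen g
    obtain ⟨u, hu, huS, rfl⟩ := exists_word hS hgen h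
    rw [← hw, ← hu, ← List.prod_append, ← Nat.cast_add, ← List.length_append]
    refine Nat.cast_le.2 (wordLength_le fun s hs => ?_)
    exact (List.mem_append.1 hs).elim (hwS s) (huS s)
  inv' g := by
    refine congrArg Nat.cast (le_antisymm (wordLength_inv_le hS hgen g) ?_)
    simpa using wordLength_inv_le hS hgen g⁻¹
  eq_one_of_map_eq_zero' g h := by
    obtain ⟨w, hw, -, rfl⟩ := exists_word hS hgen g
    have h0 : w.length = 0 := hw.trans (by exact_mod_cast h)
    rw [List.length_eq_zero_iff.1 h0, List.prod_nil]

/-- The restriction of a length function along an injective homomorphism. -/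
def compOfInjective {H : Type*} [Group H] (ℓ : GroupNorm G) (f : H →* G)
    (hf : Function.Injective f) : GroupNorm H :=
  { ℓ.toGroupSeminorm.comp f with
    eq_one_of_map_eq_zero' := fun g h =>
      (injective_iff_map_eq_one f).1 hf g (ℓ.eq_one_of_map_eq_zero' (f g) h) }

/-- The component in `N` of an element of `G`, with respect to a choice of representatives of the
left cosets of `N`. -/
def cosetComponent (N : Subgroup G) (x : G) : N :=
  ⟨(Quotient.out (x : G ⧸ N))⁻¹ * x, QuotientGroup.eq.1 (QuotientGroup.out_eq' _)⟩

lemma cosetComponent_mul (N : Subgroup G) (x : G) (n : N) :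
    cosetComponent N (x * n) = cosetComponent N x * n := by
  ext
  simp [cosetComponent, mul_assoc, QuotientGroup.mk_mul_of_mem]

lemma out_mul_cosetComponent (N : Subgroup G) (x : G) :
    Quotient.out (x : G ⧸ N) * (cosetComponent N x : G) = x := by
  simp [cosetComponent]

/-- A subgroup of finite index is undistorted: a seminorm on it is dominated by the word length of
the ambient group. Multiplication by a generator changes the component in `N` of an element only by
one of the finitely many components of products of a generator and a coset representative. -/
lemma exists_le_mul_wordLength (hfin : S.Finite) (hS : S = S⁻¹) (hgen : Subgroup.closure S = ⊤)
    (N : Subgroup G) [N.FiniteIndex] (q : GroupSeminorm N) :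
    ∃ L : ℝ, ∀ g : N, q g ≤ L * (wordLength S (g : G) + 1) := by
  have hfin' : (Set.image2 (fun s (t : G ⧸ N) => q (cosetComponent N (s * t.out))) S
      Set.univ).Finite := hfin.image2 _ Set.finite_univ
  obtain ⟨C, hC⟩ := hfin'.bddAbove
  have hC' (s : G) (hs : s ∈ S) (t : G ⧸ N) : q (cosetComponent N (s * t.out)) ≤ C :=
    hC ⟨s, hs, t, Set.mem_univ t, rfl⟩
  have hword (w : List G) (hw : ∀ s ∈ w, s ∈ S) :
      q (cosetComponent N w.prod) ≤ C * w.length + q (cosetComponent N 1) := by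
    induction w with
    | nil => simp
    | cons s w ih =>
      have h1 := ih fun t ht => hw t (List.mem_cons_of_mem _ ht)
      have h2 := hC' s (hw s List.mem_cons_self) (w.prod : G ⧸ N)
      have h3 : cosetComponent N (s * w.prod)
          = cosetComponent N (s * (w.prod : G ⧸ N).out) * cosetComponent N w.prod := by
        rw [← cosetComponent_mul, mul_assoc, out_mul_cosetComponent]
      rw [List.prod_cons, h3, List.length_cons]
      push_cast
      linarith [map_mul_le_add q (cosetComponent N (s * (w.prod : G ⧸ N).out))
        (cosetComponent N w.prod)]
  -- `C` bounds the growth per letter; the remaining constant `2 * q (cosetComponent N 1)` appears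
  -- because the representative chosen for the trivial coset need not be `1`
  refine ⟨max C (2 * q (cosetComponent N 1)), fun g => ?_⟩
  obtain ⟨w, hw, hwS, hwg⟩ := exists_word hS hgen (g : G)
  have h1 := hword w hwS
  have h2 : cosetComponent N (g : G) = cosetComponent N 1 * g := by
    rw [← cosetComponent_mul, one_mul]
  have h3 : q g ≤ q (cosetComponent N 1) + q (cosetComponent N (g : G)) := by
    have := map_mul_le_add q (cosetComponent N 1)⁻¹ (cosetComponent N (g : G))
    rwa [map_inv_eq_map, h2, inv_mul_cancel_left, ← h2] at this
  rw [hwg, hw] at h1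
  have h4 : C * wordLength S (g : G)
      ≤ max C (2 * q (cosetComponent N 1)) * wordLength S (g : G) := by
    gcongr
    exact le_max_left _ _
  linarith [le_max_right C (2 * q (cosetComponent N 1))]

end Word

end LengthGroup

end

theorem corollary3p4 (m : ℕ) :
    (∀ (X : Type*) [MetricSpace X] [ProperSpace X]
        [AddAction (Fin m → ℤ) X] [IsIsometricVAdd (Fin m → ℤ) X],
      LengthGroup.IsGeodesic X →
      LengthGroup.ActsFreely (Fin m → ℤ) X →
      LengthGroup.ActsCocompactly (Fin m → ℤ) X →
      LengthGroup.ActsProperlyDiscontinuously (Fin m → ℤ) X →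
      (∃ F : X → (Fin m → ℝ), Continuous F ∧
        ∀ (g : Fin m → ℤ) (x : X), F (g +ᵥ x) = (fun i => (g i : ℝ)) + F x) →
      ∀ x₀ : X, ∃ ℓ : GroupNorm (Multiplicative (Fin m → ℤ)),
        (∀ g : Fin m → ℤ, ℓ (Multiplicative.ofAdd g) = dist x₀ (g +ᵥ x₀)) ∧
        LengthGroup.IsProperLength ℓ.toGroupSeminorm ∧
        LengthGroup.IsSeparated ℓ.toGroupSeminorm) ∧
    (∀ (G : Type*) [Group G] (S : Set G), S.Finite → S = S⁻¹ → Subgroup.closure S = ⊤ →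
      ∀ (N : Subgroup G), N.Normal → N.FiniteIndex →
      ∀ e : Multiplicative (Fin m → ℤ) ≃* N,
      ∃ ℓ : GroupNorm (Multiplicative (Fin m → ℤ)),
        (∀ g : Multiplicative (Fin m → ℤ), ℓ g = (LengthGroup.wordLength S (e g : G) : ℝ)) ∧
        LengthGroup.IsSeparated ℓ.toGroupSeminorm) := by
  refine ⟨fun X _ _ _ _ hX hfree hc _ ⟨F, hF, hFg⟩ x₀ => ?_,
    fun G _ S hfin hS hgen N _ _ e => ?_⟩
  · obtain ⟨L, hL⟩ := LengthGroup.exists_dist_le_mul_of_equivariant hX hc hF hFg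
    have hgrowth (g : Fin m → ℤ) (i : Fin m) :
        |(g i : ℝ)| ≤ L * (LengthGroup.orbitNorm hfree x₀ (Multiplicative.ofAdd g) + 1) := by
      have h := hL (g +ᵥ x₀) x₀
      rw [hFg, dist_add_self_left, dist_comm] at h
      exact (norm_le_pi_norm (fun i => (g i : ℝ)) i).trans h
    exact ⟨LengthGroup.orbitNorm hfree x₀, fun g => rfl,
      LengthGroup.isProperLength_of_abs_le _ hgrowth, LengthGroup.isSeparated_of_abs_le _ hgrowth⟩
  · refine ⟨LengthGroup.compOfInjective (LengthGroup.wordNorm hS hgen)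
      (N.subtype.comp e.toMonoidHom) (N.subtype_injective.comp e.injective), fun g => rfl, ?_⟩
    obtain ⟨L, hL⟩ := LengthGroup.exists_le_mul_wordLength hfin hS hgen N
      ((normGroupSeminorm (Multiplicative (Fin m → ℤ))).comp e.symm.toMonoidHom)
    refine LengthGroup.isSeparated_of_abs_le _ (L := L) fun g i => ?_
    have h := hL (e (Multiplicative.ofAdd g))
    have hq : ((normGroupSeminorm (Multiplicative (Fin m → ℤ))).comp e.symm.toMonoidHom)
        (e (Multiplicative.ofAdd g)) = ‖g‖ :=
      congrArg norm (e.symm_apply_apply (Multiplicative.ofAdd g))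
    rw [hq] at h
    exact (norm_le_pi_norm g i).trans h
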